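/- All topological spaces are regular $T_1$-spaces. For topological spaces $X,Y$ let $C_k(X,Y)$ denote the space of all continuous functions $X\to Y$ with the compact-open topology. A class of topological spaces is called $C_k$-stable if it is closed under taking subspaces, homeomorphic images, countable topological sums and countable Tychonoff products, and if it contains $C_k(X,Y)$ for every Lindelöf space $X$ and every space $Y$ in the class. Let $C_k[\mathcal M]$ be the smallest $C_k$-stable class containing the class $\mathcal M$ of all metrizable spaces. A space $X$ is called a $P^{\omega_1}_\omega$-space if for every point $x\in X$, every uncountable family $\mathcal U$ of neighborhoods of $x$ has a countably infinite subfamily $\mathcal V\subset\mathcal U$ whose intersection $\bigcap\mathcal V$ is a neighborhood of $x$. Then every space $X$ in the class $C_k[\mathcal M]$ is a $P^{\omega_1}_\omega$-space. -/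

import Mathlib

open Topology

universe u

/-- A class of topological spaces (in the universe `u`). -/
abbrev SpaceClass := ∀ (X : Type u) [TopologicalSpace X], Prop

/-- A class of topological spaces is stable if it is closed under taking subspaces, homeomorphic
images, countable (possibly finite or empty) topological sums and countable Tychonoff products. -/
structure IsStableClass (P : SpaceClass.{u}) : Prop where
  subspace : ∀ (X : Type u) [TopologicalSpace X], P X → ∀ s : Set X, P s
  homeomorph : ∀ (X Y : Type u) [TopologicalSpace X] [TopologicalSpace Y],
    P X → Nonempty (X ≃ₜ Y) → P Y
  countable_sum : ∀ (ι : Type) [Countable ι] (X : ι → Type u) [∀ i, TopologicalSpace (X i)],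
    (∀ i, P (X i)) → P (Σ i, X i)
  countable_prod : ∀ (ι : Type) [Countable ι] (X : ι → Type u) [∀ i, TopologicalSpace (X i)],
    (∀ i, P (X i)) → P (∀ i, X i)

/-- A stable class is `C_k`-stable if it contains `C_k(X, Y)` (continuous maps with the compact-open
topology, Mathlib's topology on `C(X, Y)`) for all `X`, `Y` in the class with `X` Lindelöf. -/
structure IsCkStableClass (P : SpaceClass.{u}) : Prop extends IsStableClass P where
  function_space : ∀ (X Y : Type u) [TopologicalSpace X] [TopologicalSpace Y],
    LindelofSpace X → P X → P Y → P C(X, Y)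

/-- The `C_k`-stable closure of a class: the intersection of all `C_k`-stable classes
containing it. -/
def CkStableClosure (P : SpaceClass.{u}) : SpaceClass.{u} := fun X _ =>
  ∀ Q : SpaceClass.{u}, IsCkStableClass Q →
    (∀ (Z : Type u) [TopologicalSpace Z], P Z → Q Z) → Q X

/-- The closure contains the given class. -/
theorem CkStableClosure.of_mem (P : SpaceClass.{u}) (X : Type u) [TopologicalSpace X] (h : P X) :
    CkStableClosure P X := fun _ _ hPQ => hPQ X h

/-- The closure is itself `C_k`-stable, so it is the smallest `C_k`-stable class containing `P`. -/
theorem CkStableClosure.isCkStable (P : SpaceClass.{u}) :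
    IsCkStableClass (CkStableClosure P) where
  subspace X _ h s Q hQ hPQ := hQ.subspace X (h Q hQ hPQ) s
  homeomorph X Y _ _ h e Q hQ hPQ := hQ.homeomorph X Y (h Q hQ hPQ) e
  countable_sum ι _ X _ h Q hQ hPQ := hQ.countable_sum ι X fun i => h i Q hQ hPQ
  countable_prod ι _ X _ h Q hQ hPQ := hQ.countable_prod ι X fun i => h i Q hQ hPQ
  function_space X Y _ _ hL hX hY Q hQ hPQ :=
    hQ.function_space X Y hL (hX Q hQ hPQ) (hY Q hQ hPQ)

/-- The class of all metrizable topological spaces. -/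
def MetrizableClass : SpaceClass.{u} := fun X _ => TopologicalSpace.MetrizableSpace X

/-- `x` is a `P^{ω₁}_ω`-point: every uncountable family `𝒰` of neighborhoods of `x` has a countably
infinite subfamily whose intersection is a neighborhood of `x`. -/
def IsPOmegaOneOmegaPoint {X : Type u} [TopologicalSpace X] (x : X) : Prop :=
  ∀ 𝒰 : Set (Set X), (∀ U ∈ 𝒰, U ∈ 𝓝 x) → ¬ 𝒰.Countable →
    ∃ 𝒱 ⊆ 𝒰, 𝒱.Countable ∧ 𝒱.Infinite ∧ ⋂₀ 𝒱 ∈ 𝓝 x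

/-- A `P^{ω₁}_ω`-space: each point is a `P^{ω₁}_ω`-point. -/
def IsPOmegaOneOmegaSpace (X : Type u) [TopologicalSpace X] : Prop :=
  ∀ x : X, IsPOmegaOneOmegaPoint x

/-! Every space in the class embeds in some `C(M, Y)` with `M` separable metrizable and `Y`
metrizable, and every subspace of such a `C(M, Y)` has the required property.

For the property, shrink each neighborhood to a basic one: uniform closeness within a radius `1 / (n
+ 1)` on a compact set. Uncountably many share one radius, and among their compact sets a sequence
converges from above to a member of the family (`exists_seq_compact_converging`). The union of that
sequence with its limit is compact, so one basic neighborhood lies in infinitely many of the given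
ones.

For the embedding, the crux is `C(Z, W)` with `Z` Lindelöf. Such a `Z` is the image of a separable
metrizable `N` under a map that lifts compact sets (`exists_compact_covering_of_lindelofSpace`),
whence `C(Z, W) ↪ C(N, W) ↪ C(N, C(M', Y')) ↪ C(N × M', Y')`. -/

open Set Filter TopologicalSpace

/-! ### Converging compact sets and the neighborhood property -/

/-- In a second countable space, countably many open sets separate compact sets from the
complements of their open neighborhoods. -/
theorem exists_countable_isOpen_between_compact_open (M : Type*) [TopologicalSpace M]
    [SecondCountableTopology M] :
    ∃ B : Set (Set M), B.Countable ∧ (∀ b ∈ B, IsOpen b) ∧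
      ∀ K U : Set M, IsCompact K → IsOpen U → K ⊆ U → ∃ b ∈ B, K ⊆ b ∧ b ⊆ U := by
  refine ⟨sUnion '' {s | s.Finite ∧ s ⊆ countableBasis M},
    (countable_ofPred_finite_subset (countable_countableBasis M)).image _, ?_, ?_⟩
  · rintro _ ⟨s, ⟨-, hs⟩, rfl⟩
    exact isOpen_sUnion fun t ht => isOpen_of_mem_countableBasis (hs ht)
  · intro K U hK hU hKU
    have key : K ⊆ U → ∃ s : Set (Set M), s.Finite ∧ s ⊆ countableBasis M ∧ K ⊆ ⋃₀ s ∧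
        ⋃₀ s ⊆ U := by
      intro hKU
      refine hK.induction_on (p := fun L => ∃ s : Set (Set M), s.Finite ∧ s ⊆ countableBasis M ∧
        L ⊆ ⋃₀ s ∧ ⋃₀ s ⊆ U) ⟨∅, by simp⟩ ?_ ?_ ?_
      · rintro L L' hL ⟨s, h1, h2, h3, h4⟩
        exact ⟨s, h1, h2, hL.trans h3, h4⟩
      · rintro L L' ⟨s, h1, h2, h3, h4⟩ ⟨s', h1', h2', h3', h4'⟩
        refine ⟨s ∪ s', h1.union h1', union_subset h2 h2', ?_, ?_⟩
        · rw [sUnion_union]; exact union_subset_union h3 h3'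
        · rw [sUnion_union]; exact union_subset h4 h4'
      · intro x hx
        obtain ⟨b, hb, hxb, hbU⟩ := (isBasis_countableBasis M).exists_subset_of_mem_open
          (hKU hx) hU
        refine ⟨b, mem_nhdsWithin_of_mem_nhds
          ((isOpen_of_mem_countableBasis hb).mem_nhds hxb), {b}, finite_singleton _, ?_, ?_, ?_⟩
        · simpa using hb
        · simp
        · simpa using hbU
    obtain ⟨s, h1, h2, h3, h4⟩ := key hKU
    exact ⟨_, ⟨s, ⟨h1, h2⟩, rfl⟩, h3, h4⟩

/-- A compact set together with a sequence of compact sets converging to it from above in the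
Vietoris sense has compact union. -/
theorem IsCompact.union_iUnion_of_eventually_subset {M : Type*} [TopologicalSpace M] {L : Set M}
    {K : ℕ → Set M} (hL : IsCompact L) (hK : ∀ n, IsCompact (K n))
    (h : ∀ U, IsOpen U → L ⊆ U → ∀ᶠ n in atTop, K n ⊆ U) : IsCompact (L ∪ ⋃ n, K n) := by
  classical
  refine isCompact_of_finite_subcover fun {ι} U hU hLU => ?_
  obtain ⟨t, ht⟩ := hL.elim_finite_subcover U hU (subset_union_left.trans hLU)
  obtain ⟨N, hN⟩ := eventually_atTop.1 (h _ (isOpen_biUnion fun i _ => hU i) ht)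
  have hc : IsCompact (⋃ n ∈ Finset.range N, K n) := (Finset.range N).isCompact_biUnion fun n _ => hK n
  obtain ⟨t', ht'⟩ := hc.elim_finite_subcover U hU
    ((iUnion₂_subset fun n _ => (subset_iUnion K n).trans subset_union_right).trans hLU)
  refine ⟨t ∪ t', ?_⟩
  rw [Finset.set_biUnion_union]
  refine union_subset (ht.trans subset_union_left) (iUnion_subset fun n => ?_)
  rcases lt_or_ge n N with hn | hn
  · exact ((subset_biUnion_of_mem (u := K) (Finset.mem_coe.2 (Finset.mem_range.2 hn))).trans
      ht').trans subset_union_right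
  · exact (hN n hn).trans subset_union_left

/-- An uncountable family of compact subsets of a second countable space contains a sequence of
distinct indices along which the compact sets converge to a member of the family. -/
theorem exists_seq_compact_converging {M α : Type*} [TopologicalSpace M]
    [SecondCountableTopology M] {S : Set α} (hS : ¬ S.Countable) {K : α → Set M}
    (hK : ∀ a ∈ S, IsCompact (K a)) :
    ∃ a₀ ∈ S, ∃ a : ℕ → α, Function.Injective a ∧ (∀ n, a n ∈ S) ∧
      ∀ U, IsOpen U → K a₀ ⊆ U → ∀ᶠ n in atTop, K (a n) ⊆ U := by
  classical
  obtain ⟨B, hB, hBo, hBK⟩ := exists_countable_isOpen_between_compact_open M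
  -- Otherwise `S` would be a union of countably many countable sets, one for each bad `b ∈ B`.
  obtain ⟨a₀, ha₀, h₀⟩ : ∃ a₀ ∈ S, ∀ b ∈ B, K a₀ ⊆ b → ¬ {a ∈ S | K a ⊆ b}.Countable := by
    by_contra! hcon
    choose! b hb hab hcount using hcon
    have hsub : S ⊆ ⋃ b ∈ {b ∈ B | {a ∈ S | K a ⊆ b}.Countable}, {a ∈ S | K a ⊆ b} :=
      fun a ha => mem_iUnion₂.2 ⟨b a, ⟨hb a ha, hcount a ha⟩, ha, hab a ha⟩
    refine hS (Countable.mono hsub (Countable.biUnion (hB.mono (sep_subset B _)) ?_))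
    exact fun b hb => hb.2
  have hne : {b ∈ B | K a₀ ⊆ b}.Nonempty := by
    obtain ⟨b, hb, h, -⟩ := hBK _ _ (hK a₀ ha₀) isOpen_univ (subset_univ _)
    exact ⟨b, hb, h⟩
  obtain ⟨c, hc⟩ := (hB.mono (sep_subset B fun b => K a₀ ⊆ b)).exists_eq_range hne
  have hcmem : ∀ n, c n ∈ B ∧ K a₀ ⊆ c n := fun n => hc.symm.subset (mem_range_self n)
  have hinf : ∀ n : ℕ, {a ∈ S | K a ⊆ ⋂ i ∈ Finset.range (n + 1), c i}.Infinite := by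
    intro n hfin
    obtain ⟨b, hb, h1, h2⟩ := hBK (K a₀) (⋂ i ∈ Finset.range (n + 1), c i) (hK a₀ ha₀)
      (isOpen_biInter_finset fun i _ => hBo _ (hcmem i).1)
      (subset_iInter₂ fun i _ => (hcmem i).2)
    refine h₀ b hb h1 (Countable.mono ?_ hfin.countable)
    exact fun a ha => ⟨ha.1, ha.2.trans h2⟩
  -- The first coordinate is a strictly increasing level, which forces convergence; the inequality
  -- of second coordinates gives injectivity.
  obtain ⟨f, hf, hlt⟩ := exists_seq_of_forall_finset_exists
    (fun p : ℕ × α => p.2 ∈ {a ∈ S | K a ⊆ ⋂ i ∈ Finset.range (p.1 + 1), c i})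
    (fun p q => p.1 < q.1 ∧ p.2 ≠ q.2) (fun s _ => by
      obtain ⟨a, ha, has⟩ := (hinf (s.sup Prod.fst + 1)).exists_notMem_finset (s.image Prod.snd)
      refine ⟨(s.sup Prod.fst + 1, a), ha, fun x hx => ⟨?_, ?_⟩⟩
      · exact Nat.lt_succ_of_le (Finset.le_sup (f := Prod.fst) hx)
      · rintro rfl
        exact has (Finset.mem_image_of_mem _ hx))
  have hmono : StrictMono fun n => (f n).1 := fun m n h => (hlt m n h).1
  refine ⟨a₀, ha₀, fun n => (f n).2, ?_, fun n => (hf n).1, fun U hU hKU => ?_⟩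
  · intro m n h
    by_contra hmn
    rcases lt_or_gt_of_ne hmn with h' | h'
    · exact (hlt _ _ h').2 h
    · exact (hlt _ _ h').2 h.symm
  · obtain ⟨b, hb, h1, h2⟩ := hBK _ _ (hK a₀ ha₀) hU hKU
    obtain ⟨k, rfl⟩ : b ∈ range c := hc.subset ⟨hb, h1⟩
    refine eventually_atTop.2 ⟨k, fun n hn => ?_⟩
    refine ((hf n).2.trans (biInter_subset_of_mem (Finset.mem_coe.2 (Finset.mem_range.2 ?_)))).trans h2
    exact Nat.lt_succ_of_le (hn.trans (hmono.id_le n))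

/-- Stated for an inducing map, so that it covers all subspaces of `C(M, Y)` at once. -/
theorem ContinuousMap.isPOmegaOneOmegaSpace (M : Type*) (Y : Type u) [TopologicalSpace M]
    [SecondCountableTopology M] [PseudoMetricSpace Y] {Z : Type u} [TopologicalSpace Z]
    {f : Z → C(M, Y)} (hf : IsInducing f) : IsPOmegaOneOmegaSpace Z := by
  intro z 𝒰 h𝒰 hunc
  have hbas : (𝓝 z).HasBasis (fun p : Set M × ℕ => IsCompact p.1 ∧ True)
      fun p => {w | ∀ x ∈ p.1, dist (f w x) (f z x) < 1 / (p.2 + 1)} := by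
    rw [hf.nhds_eq_comap]
    exact (nhds_basis_uniformity
      (Metric.uniformity_basis_dist_inv_nat_succ.compactConvergenceUniformity)).comap f
  have hex : ∀ U ∈ 𝒰, ∃ p : Set M × ℕ, IsCompact p.1 ∧
      {w | ∀ x ∈ p.1, dist (f w x) (f z x) < 1 / ((p.2 : ℝ) + 1)} ⊆ U := fun U hU => by
    obtain ⟨p, hp, hpU⟩ := hbas.mem_iff.1 (h𝒰 U hU)
    exact ⟨p, hp.1, hpU⟩
  choose! p hpc hpU using hex
  obtain ⟨n, hn⟩ : ∃ n, ¬ {U ∈ 𝒰 | (p U).2 = n}.Countable := by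
    by_contra! h
    refine hunc (Countable.mono (fun U hU => ?_) (countable_iUnion h))
    exact mem_iUnion.2 ⟨(p U).2, hU, rfl⟩
  obtain ⟨U₀, hU₀, a, hinj, ha, hconv⟩ :=
    exists_seq_compact_converging hn (K := fun U => (p U).1) fun U hU => hpc U hU.1
  refine ⟨range a, range_subset_iff.2 fun k => (ha k).1, countable_range a,
    infinite_range_of_injective hinj, ?_⟩
  have hc := (hpc U₀ hU₀.1).union_iUnion_of_eventually_subset (fun k => hpc _ (ha k).1) hconv
  refine mem_of_superset (hbas.mem_of_mem (i := (_, n)) ⟨hc, trivial⟩) ?_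
  rintro w hw _ ⟨k, rfl⟩
  refine hpU _ (ha k).1 fun x hx => ?_
  rw [(ha k).2]
  exact hw x (Or.inr (mem_iUnion.2 ⟨k, hx⟩))

/-! ### Compact-covering images of separable metrizable spaces -/

/-- Michael's construction: a regular space with a countable closed family which separates
compact sets from the complements of their subbasic neighborhoods is a compact-covering image of a
separable metrizable space. -/
theorem exists_compact_covering_of_countable_kNetwork {Z : Type*} [t : TopologicalSpace Z] [T3Space Z]
    {S : Set (Set Z)} (hS : t = generateFrom S) {𝒩 : Set (Set Z)} (h𝒩 : 𝒩.Countable)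
    (hcl : ∀ N ∈ 𝒩, IsClosed N)
    (hnet : ∀ K : Set Z, ∀ U ∈ S, IsCompact K → K ⊆ U → ∃ N ∈ 𝒩, K ⊆ N ∧ N ⊆ U) :
    ∃ (M : Set (Finset ℕ → ℕ)) (p : C(M, Z)),
      ∀ K : Set Z, IsCompact K → ∃ L : Set M, IsCompact L ∧ p '' L = K := by
  classical
  have hSo : ∀ U ∈ S, IsOpen U := fun U hU => by
    rw [hS]; exact isOpen_generateFrom_of_mem hU
  have hnhds : ∀ z : Z, 𝓝 z = ⨅ s ∈ {s | z ∈ s ∧ s ∈ S}, 𝓟 s := fun z => by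
    subst hS; exact nhds_generateFrom
  obtain ⟨N, hN⟩ := (h𝒩.insert univ).exists_eq_range (insert_nonempty _ _)
  obtain ⟨n₀, hn₀⟩ : univ ∈ range N := hN.subset (mem_insert _ _)
  have hNcl : ∀ n, IsClosed (N n) := fun n => by
    rcases hN.symm.subset (mem_range_self n) with h | h
    · rw [h]; exact isClosed_univ
    · exact hcl _ h
  have hNnet : ∀ K : Set Z, ∀ U ∈ S, IsCompact K → K ⊆ U → ∃ n, K ⊆ N n ∧ N n ⊆ U := by
    intro K U hU hK hKU
    obtain ⟨A, hA, h1, h2⟩ := hnet K U hU hK hKU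
    obtain ⟨n, rfl⟩ := hN.subset (mem_insert_of_mem _ hA)
    exact ⟨n, h1, h2⟩
  -- A code `s` for `z` picks network members around `z` that enter every subbasic neighborhood.
  -- Coordinates are indexed by `Finset ℕ` because the code of a point of `K` will choose from each
  -- finite cover of `K`.
  let R : (Finset ℕ → ℕ) → Z → Prop := fun s z =>
    (∀ F, z ∈ N (s F)) ∧ ∀ U ∈ S, z ∈ U → ∃ F, N (s F) ⊆ U
  have huniq : ∀ s z w, R s z → R s w → z = w := by
    intro s z w hz hw
    refine (specializes_iff_eq.1 (?_ : w ⤳ z)).symm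
    rw [Specializes, hnhds z]
    refine le_iInf₂ fun U hU => le_principal_iff.2 ((hSo U hU.2).mem_nhds ?_)
    obtain ⟨F, hF⟩ := hz.2 U hU.2 hU.1
    exact hF (hw.1 F)
  let M : Set (Finset ℕ → ℕ) := {s | ∃ z, R s z}
  choose q hq using fun s : M => s.2
  have hqc : Continuous q := by
    rw [continuous_iff_continuousAt]
    intro s
    rw [ContinuousAt, hnhds (q s), tendsto_iInf]
    refine fun U => tendsto_iInf.2 fun hU => tendsto_principal.2 ?_
    obtain ⟨F, hF⟩ := (hq s).2 U hU.2 hU.1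
    have : ∀ᶠ s' : M in 𝓝 s, s'.1 F = s.1 F :=
      ((continuous_apply F).comp continuous_subtype_val).continuousAt.eventually
        ((isOpen_discrete {s.1 F}).mem_nhds rfl)
    filter_upwards [this] with s' hs'
    refine hF ?_
    rw [← hs']
    exact (hq s').1 F
  refine ⟨M, ⟨q, hqc⟩, fun K hK => ?_⟩
  -- One network member inside `U` covers `K` near `z`; the compact remainder is covered by finitely
  -- many members that miss `z`.
  have hcover : ∀ z ∈ K, ∀ U ∈ S, z ∈ U →
      ∃ F : Finset ℕ, K ⊆ ⋃ n ∈ F, N n ∧ ∀ n ∈ F, z ∈ N n → N n ⊆ U := by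
    intro z hz U hU hzU
    obtain ⟨V, hV, hVcl, hVU⟩ := exists_mem_nhds_isClosed_subset ((hSo U hU).mem_nhds hzU)
    obtain ⟨n, hn, hnU⟩ := hNnet (K ∩ V) U hU (hK.inter_right hVcl) (inter_subset_right.trans hVU)
    have hsep : ∀ w : Z, w ≠ z → ∃ W ∈ S, w ∈ W ∧ z ∉ W := by
      intro w hwz
      by_contra! hcon
      refine hwz (specializes_iff_eq.1 (?_ : z ⤳ w)).symm
      rw [Specializes, hnhds w]
      exact le_iInf₂ fun W hW => le_principal_iff.2
        ((hSo W hW.2).mem_nhds (hcon W hW.2 hW.1))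
    choose! W hWS hwW hzW using hsep
    have hne : ∀ w ∈ K \ interior V, w ≠ z := by
      rintro w hw rfl
      exact hw.2 (mem_interior_iff_mem_nhds.2 hV)
    have hK2 : IsCompact (K \ interior V) := hK.diff isOpen_interior
    obtain ⟨T, hT, hTcov⟩ := hK2.elim_nhds_subcover W fun w hw =>
      (hSo _ (hWS w (hne w hw))).mem_nhds (hwW w (hne w hw))
    obtain ⟨L, hLc, hLW, hLU⟩ := hK2.finite_compact_cover T W
      (fun w hw => hSo _ (hWS w (hne w (hT w hw)))) hTcov
    have hm : ∀ w ∈ T, ∃ m, L w ⊆ N m ∧ N m ⊆ W w := fun w hw =>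
      hNnet _ _ (hWS w (hne w (hT w hw))) (hLc w) (hLW w)
    choose! m hm1 hm2 using hm
    refine ⟨insert n (T.image m), fun x hx => ?_, fun k hk hzk => ?_⟩
    · by_cases hxV : x ∈ interior V
      · exact mem_biUnion (Finset.mem_coe.2 (Finset.mem_insert_self _ _))
          (hn ⟨hx, interior_subset hxV⟩)
      · have : x ∈ ⋃ i ∈ T, L i := hLU ▸ ⟨hx, hxV⟩
        obtain ⟨w, hw, hxw⟩ := mem_iUnion₂.1 this
        exact mem_biUnion (Finset.mem_coe.2 (Finset.mem_insert_of_mem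
          (Finset.mem_image_of_mem m hw))) (hm1 w hw hxw)
    · rcases Finset.mem_insert.1 hk with rfl | hk
      · exact hnU
      · obtain ⟨w, hw, rfl⟩ := Finset.mem_image.1 hk
        exact absurd (hm2 w hw hzk) (hzW w (hne w (hT w hw)))
  -- The default `{n₀}`, where `N n₀ = univ`, makes every `B F` index a cover of `K`.
  let B : Finset ℕ → Finset ℕ := fun F => if K ⊆ ⋃ n ∈ F, N n then F else {n₀}
  have hB : ∀ F, K ⊆ ⋃ n ∈ B F, N n := by
    intro F
    by_cases h : K ⊆ ⋃ n ∈ F, N n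
    · simpa only [B, if_pos h] using h
    · simp [B, if_neg h, hn₀]
  have hRmem : ∀ s z, z ∈ K → (∀ F, s F ∈ B F ∧ z ∈ N (s F)) → R s z := by
    intro s z hz hs
    refine ⟨fun F => (hs F).2, fun U hU hzU => ?_⟩
    obtain ⟨F, hF, hFU⟩ := hcover z hz U hU hzU
    refine ⟨F, hFU _ ?_ (hs F).2⟩
    have := (hs F).1
    simpa only [B, if_pos hF] using this
  -- Pairs of a code and its point, closed in a product of finite sets with `K`; the codes form the
  -- compact lift.
  let T : Set ((Finset ℕ → ℕ) × Z) :=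
    ((univ.pi fun F => (B F : Set ℕ)) ×ˢ K) ∩ ⋂ F, {x | x.2 ∈ N (x.1 F)}
  have hT : IsCompact T := by
    refine ((isCompact_univ_pi fun F => (B F).finite_toSet.isCompact).prod hK).inter_right
      (isClosed_iInter fun F => ?_)
    have h1 : IsClosed {y : ℕ × Z | y.2 ∈ N y.1} := by
      rw [← isOpen_compl_iff, isOpen_prod_iff]
      intro n z hz
      refine ⟨{n}, (N n)ᶜ, isOpen_discrete _, (hNcl n).isOpen_compl, rfl, hz, ?_⟩
      rintro ⟨k, y⟩ ⟨rfl, hy⟩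
      exact hy
    exact h1.preimage (f := fun x : (Finset ℕ → ℕ) × Z => (x.1 F, x.2)) (by fun_prop)
  have hTM : ∀ x ∈ T, R x.1 x.2 := fun x hx => hRmem _ _ hx.1.2 fun F =>
    ⟨hx.1.1 F (mem_univ _), mem_iInter.1 hx.2 F⟩
  refine ⟨Subtype.val ⁻¹' (Prod.fst '' T), ?_, ?_⟩
  · rw [Subtype.isCompact_iff, Subtype.image_preimage_coe, inter_eq_right.2]
    · exact hT.image continuous_fst
    · rintro _ ⟨x, hx, rfl⟩
      exact ⟨x.2, hTM x hx⟩
  · apply Subset.antisymm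
    · rintro _ ⟨s, ⟨x, hx, hxs⟩, rfl⟩
      change q s ∈ K
      rw [huniq s _ _ (hq s) (hxs ▸ hTM x hx)]
      exact hx.1.2
    · intro z hz
      have hex : ∀ F, ∃ n ∈ B F, z ∈ N n := fun F => by simpa using hB F hz
      choose s hs hzs using hex
      have hsT : (s, z) ∈ T := ⟨⟨fun F _ => hs F, hz⟩, mem_iInter.2 hzs⟩
      exact ⟨⟨s, z, hTM _ hsT⟩, ⟨_, hsT, rfl⟩, huniq s _ _ (hq ⟨s, z, hTM _ hsT⟩) (hTM _ hsT)⟩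

/-- Tails of a convergent sequence, with the limit, eventually lie in any neighborhood
of the limit. -/
theorem exists_isCompact_tail {M : Type*} [TopologicalSpace M] {x : ℕ → M} {a : M}
    (hx : Tendsto x atTop (𝓝 a)) {W : Set M} (hW : W ∈ 𝓝 a) :
    ∃ C ⊆ W, IsCompact C ∧ a ∈ C ∧ ∀ᶠ n in atTop, x n ∈ C := by
  obtain ⟨m, hm⟩ := eventually_atTop.1 (hx.eventually hW)
  refine ⟨insert a (range fun n => x (n + m)), ?_,
    ((tendsto_add_atTop_iff_nat m).2 hx).isCompact_insert_range, mem_insert _ _,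
    eventually_atTop.2 ⟨m, fun n hn => Or.inr ⟨n - m, by simp [hn]⟩⟩⟩
  refine insert_subset (mem_of_mem_nhds hW) (range_subset_iff.2 fun n => hm _ (by omega))

/-- For a compact set of continuous functions on a sequential space, the points all of whose
values lie in a given open set form an open set. -/
theorem IsCompact.isOpen_setOf_forall_mem {Z M Y : Type*} [TopologicalSpace Z] [TopologicalSpace M]
    [SequentialSpace M] [TopologicalSpace Y] {f : Z → C(M, Y)} (hf : Continuous f) {K : Set Z}
    (hK : IsCompact K) {V : Set Y} (hV : IsOpen V) : IsOpen {x | ∀ z ∈ K, f z x ∈ V} := by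
  rw [← isClosed_compl_iff]
  refine IsSeqClosed.isClosed fun x a hx hxa ha => ?_
  have hx' : ∀ n, ∃ z ∈ K, f z (x n) ∉ V := fun n => by simpa using hx n
  choose z hzK hz using hx'
  -- A cluster point `w` of the bad functions sends a compact tail of `x` into `V`; so do all
  -- functions near `w`, a contradiction.
  obtain ⟨w, hw, hcl⟩ := hK.exists_mapClusterPt_of_frequently (l := atTop) (f := z)
    (Frequently.of_forall hzK)
  obtain ⟨C, hCV, hC, -, hxC⟩ := exists_isCompact_tail hxa
    ((f w).continuous.continuousAt.preimage_mem_nhds (hV.mem_nhds (ha w hw)))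
  have hev : ∀ᶠ y in 𝓝 w, MapsTo (f y) C V :=
    hf.continuousAt.eventually (ContinuousMap.eventually_mapsTo hC hV hCV)
  obtain ⟨n, hn, hnC⟩ := ((hcl.frequently hev).and_eventually hxC).exists
  exact hz n (hn hnC)

/-- A space embedded in the space of continuous functions between separable metrizable spaces is a
compact-covering image of a separable metrizable space. -/
theorem exists_compact_covering_of_isEmbedding {Z M Y : Type*} [TopologicalSpace Z]
    [TopologicalSpace M] [SecondCountableTopology M] [TopologicalSpace Y]
    [SecondCountableTopology Y] [T3Space Y] {f : Z → C(M, Y)} (hf : IsEmbedding f) :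
    ∃ (M' : Set (Finset ℕ → ℕ)) (p : C(M', Z)),
      ∀ K : Set Z, IsCompact K → ∃ L : Set M', IsCompact L ∧ p '' L = K := by
  have : T3Space Z := hf.t3Space
  obtain ⟨B, hB, hBo, hBK⟩ := exists_countable_isOpen_between_compact_open M
  obtain ⟨D, hD, hDo, hDK⟩ := exists_countable_isOpen_between_compact_open Y
  refine exists_compact_covering_of_countable_kNetwork (Z := Z)
    (S := preimage f '' {s | ∃ K, IsCompact K ∧ ∃ U, IsOpen U ∧ {g : C(M, Y) | MapsTo g K U} = s})
    (𝒩 := image2 (fun b d => {z | MapsTo (f z) b (closure d)}) B D) ?_ (hB.image2 hD _) ?_ ?_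
  · rw [hf.eq_induced, ContinuousMap.compactOpen_eq, induced_generateFrom_eq]
    rfl
  · rintro _ ⟨b, hb, d, hd, rfl⟩
    exact (ContinuousMap.isClosed_setOfPred_mapsTo isClosed_closure b).preimage hf.continuous
  · rintro K _ ⟨_, ⟨C, hC, V, hV, rfl⟩, rfl⟩ hK hKV
    have : CompactSpace C := isCompact_iff_compactSpace.1 hC
    have hE : IsCompact ((fun q : Z × C => f q.1 q.2) '' (K ×ˢ univ)) := by
      refine (hK.prod isCompact_univ).image ?_
      have h1 : Continuous fun z : Z => (f z).restrict C :=
        (ContinuousMap.continuous_restrict C).comp hf.continuous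
      exact (h1.comp continuous_fst).eval continuous_snd
    have hEV : (fun q : Z × C => f q.1 q.2) '' (K ×ˢ univ) ⊆ V := by
      rintro _ ⟨⟨z, x⟩, hzx, rfl⟩
      exact hKV hzx.1 x.2
    -- The intermediate `W` leaves room for `closure d` inside `V`, as the network members are
    -- defined with closures.
    obtain ⟨W, hWo, hEW, hWV⟩ := hE.exists_isOpen_closure_subset (hV.mem_nhdsSet.2 hEV)
    obtain ⟨d, hd, hEd, hdW⟩ := hDK _ W hE hWo hEW
    obtain ⟨b, hb, hCb, hbd⟩ := hBK C _ hC (hK.isOpen_setOf_forall_mem hf.continuous (hDo d hd))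
      fun x hx z hz => hEd ⟨(z, ⟨x, hx⟩), ⟨hz, mem_univ _⟩, rfl⟩
    refine ⟨_, mem_image2_of_mem hb hd, fun z hz x hx => subset_closure (hbd hx z hz), ?_⟩
    exact fun z hz x hx => hWV (closure_mono hdW (hz (hCb hx)))

/-- A Lindelöf space of continuous functions from a separable space to a metrizable space takes
its values in a separable subset. -/
theorem exists_isSeparable_forall_mem {Z M Y : Type*} [TopologicalSpace Z] [LindelofSpace Z]
    [TopologicalSpace M] [SeparableSpace M] [TopologicalSpace Y]
    [PseudoMetrizableSpace Y] {f : Z → C(M, Y)} (hf : Continuous f) :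
    ∃ T : Set Y, IsSeparable T ∧ ∀ z x, f z x ∈ T := by
  let _ := pseudoMetrizableSpacePseudoMetric Y
  obtain ⟨D, hD, hDd⟩ := exists_countable_dense M
  -- Evaluation at each point of the countable dense set has Lindelöf, hence separable, range;
  -- continuity puts all other values in the closure.
  refine ⟨closure (⋃ d : D, range fun z => f z d), ?_, fun z x => ?_⟩
  · have : Countable D := hD.to_subtype
    refine (IsSeparable.iUnion fun d : D => ?_).closure
    have hL : IsLindelof (range fun z => f z d) :=
      isLindelof_range ((ContinuousEvalConst.continuous_eval_const d.1).comp hf)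
    obtain ⟨t, -, htc, hts⟩ := EMetric.subset_countable_closure_of_almost_dense_set
      (range fun z => f z d) fun ε hε => by
        obtain ⟨t, ht, -, hts⟩ := hL.elim_nhds_subcover (fun y => Metric.closedEBall y ε)
          fun y _ => Metric.closedEBall_mem_nhds y hε
        exact ⟨t, ht, hts⟩
    exact ⟨t, htc, hts⟩
  · exact closure_mono (by
      rintro _ ⟨d, hd, rfl⟩
      exact mem_iUnion.2 ⟨⟨d, hd⟩, z, rfl⟩)
      (image_closure_subset_closure_image (f z).continuous ⟨x, hDd x, rfl⟩)

/-- The Lindelöf property confines all values to a separable part of `Y`, so `Y` may be replaced by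
a second countable space. -/
theorem exists_compact_covering_of_lindelofSpace {Z M Y : Type*} [TopologicalSpace Z]
    [LindelofSpace Z] [TopologicalSpace M] [SecondCountableTopology M] [TopologicalSpace Y]
    [MetrizableSpace Y] {f : Z → C(M, Y)} (hf : IsEmbedding f) :
    ∃ (M' : Set (Finset ℕ → ℕ)) (p : C(M', Z)),
      ∀ K : Set Z, IsCompact K → ∃ L : Set M', IsCompact L ∧ p '' L = K := by
  obtain ⟨T, hT, hfT⟩ := exists_isSeparable_forall_mem hf.continuous
  let _ := metrizableSpaceMetric Y
  have : SeparableSpace T := hT.separableSpace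
  have : SecondCountableTopology T := UniformSpace.secondCountable_of_separable T
  let i : C(T, Y) := ⟨Subtype.val, continuous_subtype_val⟩
  have hi : IsEmbedding (i.comp : C(M, T) → C(M, Y)) := i.isEmbedding_postcomp .subtypeVal
  let g : Z → C(M, T) := fun z => ⟨fun x => ⟨f z x, hfT z x⟩, by fun_prop⟩
  have hg : (i.comp : C(M, T) → C(M, Y)) ∘ g = f := rfl
  have hgc : Continuous g := hi.continuous_iff.2 hf.continuous
  exact exists_compact_covering_of_isEmbedding (IsEmbedding.of_comp hgc hi.continuous (hg ▸ hf))

/-! ### Embeddings between function spaces -/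

/-- Precomposition with a compact-covering map is an embedding of function spaces. -/
theorem ContinuousMap.isEmbedding_precomp_of_compact_covering {N Z W : Type*} [TopologicalSpace N]
    [TopologicalSpace Z] [TopologicalSpace W] (p : C(N, Z))
    (hp : ∀ K : Set Z, IsCompact K → ∃ L : Set N, IsCompact L ∧ p '' L = K) :
    IsEmbedding fun g : C(Z, W) => g.comp p := by
  refine ⟨isInducing_iff_nhds.2 fun g => le_antisymm
    ((ContinuousMap.continuous_precomp p).continuousAt.tendsto.le_comap) ?_, fun g g' h => ?_⟩
  · rw [← tendsto_id', ContinuousMap.tendsto_nhds_compactOpen]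
    intro K hK U hU hg
    obtain ⟨L, hL, rfl⟩ := hp K hK
    have h : ∀ᶠ h : C(N, W) in 𝓝 (g.comp p), MapsTo h L U :=
      ContinuousMap.eventually_mapsTo hL hU fun x hx => hg (mem_image_of_mem p hx)
    filter_upwards [tendsto_comap.eventually h] with g' hg'
    rintro _ ⟨x, hx, rfl⟩
    exact hg' hx
  · ext z
    obtain ⟨L, -, hL⟩ := hp {z} isCompact_singleton
    obtain ⟨x, -, rfl⟩ : z ∈ p '' L := hL ▸ mem_singleton z
    exact DFunLike.congr_fun h x

/-- A continuous map into a function space with sequential domain is jointly continuous along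
sequential products. -/
theorem ContinuousMap.continuous_uncurry_of_sequentialSpace {N M Y : Type*} [TopologicalSpace N]
    [TopologicalSpace M] [SequentialSpace (N × M)] [TopologicalSpace Y] (F : C(N, C(M, Y))) :
    Continuous fun q : N × M => F q.1 q.2 := by
  refine SeqContinuous.continuous fun x a hx => ?_
  have h1 : Tendsto (fun n => (x n).1) atTop (𝓝 a.1) := (continuous_fst.tendsto a).comp hx
  have h2 : Tendsto (fun n => (x n).2) atTop (𝓝 a.2) := (continuous_snd.tendsto a).comp hx
  rw [tendsto_def]
  intro V hV
  obtain ⟨U, hUV, hU, haU⟩ := mem_nhds_iff.1 hV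
  obtain ⟨C, hCU, hC, -, hxC⟩ := exists_isCompact_tail h2
    ((F a.1).continuous.continuousAt.preimage_mem_nhds (hU.mem_nhds haU))
  filter_upwards [h1.eventually (F.continuous.continuousAt.eventually
    (ContinuousMap.eventually_mapsTo hC hU hCU)), hxC] with n hn hnC
  exact hUV (hn hnC)

/-- Uncurrying of continuous maps when the product is sequential. -/
def ContinuousMap.seqUncurry {N M Y : Type*} [TopologicalSpace N] [TopologicalSpace M]
    [SequentialSpace (N × M)] [TopologicalSpace Y] (F : C(N, C(M, Y))) : C(N × M, Y) :=
  ⟨fun q => F q.1 q.2, F.continuous_uncurry_of_sequentialSpace⟩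

/-- Uncurrying is an embedding of function spaces when the product is sequential. -/
theorem ContinuousMap.isEmbedding_seqUncurry (N M Y : Type*) [TopologicalSpace N]
    [TopologicalSpace M] [SequentialSpace (N × M)] [UniformSpace Y] :
    IsEmbedding (ContinuousMap.seqUncurry : C(N, C(M, Y)) → C(N × M, Y)) := by
  refine ⟨isInducing_iff_nhds.2 fun F => le_antisymm ?_ ?_, fun F G h => ?_⟩
  · rw [← tendsto_iff_comap, ContinuousMap.tendsto_iff_forall_isCompact_tendstoUniformlyOn]
    intro K hK V hV
    have hF := ContinuousMap.tendsto_iff_forall_isCompact_tendstoUniformlyOn.1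
      (tendsto_id (α := C(N, C(M, Y))) (x := 𝓝 F)) _ (hK.image continuous_fst)
      _ (ContinuousMap.hasBasis_compactConvergenceUniformity.mem_of_mem
        (i := (Prod.snd '' K, V)) ⟨hK.image continuous_snd, hV⟩)
    filter_upwards [hF] with G hG q hq
    exact hG q.1 (mem_image_of_mem _ hq) q.2 (mem_image_of_mem _ hq)
  · rw [← tendsto_id', ContinuousMap.tendsto_iff_forall_isCompact_tendstoUniformlyOn]
    intro A hA V hV
    obtain ⟨⟨B, W⟩, ⟨hB, hW⟩, hBW⟩ :=
      ContinuousMap.hasBasis_compactConvergenceUniformity.mem_iff.1 hV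
    have hF := ContinuousMap.tendsto_iff_forall_isCompact_tendstoUniformlyOn.1
      (tendsto_comap (f := ContinuousMap.seqUncurry) (x := 𝓝 F.seqUncurry)) _
      (hA.prod hB) W hW
    filter_upwards [hF] with G hG a ha
    exact hBW fun b hb => hG (a, b) ⟨ha, hb⟩
  · ext a b
    exact DFunLike.congr_fun h (a, b)

/-- A compact subset of a topological sum meets only finitely many summands. -/
theorem ContinuousMap.continuous_sigma {ι : Type*} {M : ι → Type*} {Y : Type*}
    [∀ i, TopologicalSpace (M i)] [TopologicalSpace Y] :
    Continuous fun g : ∀ i, C(M i, Y) => ContinuousMap.sigma g := by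
  refine ContinuousMap.continuous_compactOpen.2 fun K hK U hU => ?_
  have hfin : (Sigma.fst '' K).Finite := by
    let _ : TopologicalSpace ι := ⊥
    have : DiscreteTopology ι := ⟨rfl⟩
    exact (hK.image (_root_.continuous_sigma fun i => continuous_const)).finite_of_discrete
  have heq : {g : ∀ i, C(M i, Y) | MapsTo (ContinuousMap.sigma g) K U} =
      ⋂ i ∈ Sigma.fst '' K, (fun g : ∀ i, C(M i, Y) => g i) ⁻¹'
        {h | MapsTo h (Sigma.mk i ⁻¹' K) U} := by
    ext g
    simp only [mem_iInter, mem_preimage]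
    constructor
    · exact fun h i _ x hx => h hx
    · exact fun h x hx => h x.1 ⟨x, hx, rfl⟩ (x := x.2) hx
  rw [heq]
  exact hfin.isOpen_biInter fun i _ => (ContinuousMap.isOpen_setOfPred_mapsTo
    (IsClosedEmbedding.sigmaMk.isCompact_preimage hK) hU).preimage (continuous_apply i)

theorem ContinuousMap.isEmbedding_sigma {ι : Type*} {M : ι → Type*} {Y : Type*}
    [∀ i, TopologicalSpace (M i)] [TopologicalSpace Y] :
    IsEmbedding fun g : ∀ i, C(M i, Y) => ContinuousMap.sigma g := by
  refine Topology.IsEmbedding.of_leftInverse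
    (f := fun (h : C(Σ i, M i, Y)) i => h.comp (ContinuousMap.sigmaMk i)) (fun g => rfl)
    (continuous_pi fun i => ContinuousMap.continuous_precomp _) ContinuousMap.continuous_sigma

instance metrizableSpace_sigma {ι : Type*} (Y : ι → Type*) [∀ i, TopologicalSpace (Y i)]
    [∀ i, MetrizableSpace (Y i)] : MetrizableSpace (Σ i, Y i) := by
  let _ := fun i => metrizableSpaceMetric (Y i)
  let _ : MetricSpace (Σ i, Y i) := Metric.Sigma.metricSpace
  infer_instance

instance metrizableSpace_sum (X Y : Type*) [TopologicalSpace X] [TopologicalSpace Y]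
    [MetrizableSpace X] [MetrizableSpace Y] : MetrizableSpace (X ⊕ Y) := by
  let _ := metrizableSpaceMetric X
  let _ := metrizableSpaceMetric Y
  let _ : MetricSpace (X ⊕ Y) := Metric.metricSpaceSum
  infer_instance

/-! ### Stability of the class of embeddable spaces -/

/-- The space embeds into the space of continuous functions from a separable metrizable space to a
metrizable space. -/
def EmbedsInFunctionSpace (Z : Type u) [TopologicalSpace Z] : Prop :=
  ∃ (M : Type) (_ : TopologicalSpace M) (_ : MetrizableSpace M) (_ : SecondCountableTopology M)
    (Y : Type u) (_ : TopologicalSpace Y) (_ : MetrizableSpace Y) (f : Z → C(M, Y)), IsEmbedding f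

theorem EmbedsInFunctionSpace.of_metrizableSpace (Z : Type u) [TopologicalSpace Z]
    [MetrizableSpace Z] : EmbedsInFunctionSpace Z :=
  ⟨Unit, inferInstance, inferInstance, inferInstance, Z, inferInstance, inferInstance,
    Homeomorph.continuousMapOfUnique, Homeomorph.isEmbedding _⟩

theorem EmbedsInFunctionSpace.of_isEmbedding {Z W : Type u} [TopologicalSpace Z]
    [TopologicalSpace W] (hW : EmbedsInFunctionSpace W) {e : Z → W} (he : IsEmbedding e) :
    EmbedsInFunctionSpace Z := by
  obtain ⟨M, _, _, _, Y, _, _, f, hf⟩ := hW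
  exact ⟨M, inferInstance, inferInstance, inferInstance, Y, inferInstance, inferInstance, _,
    hf.comp he⟩

/-- Over an empty domain the function space is a point, so the domain can be replaced by `Unit`.
Sums need this: constant functions must determine their values. -/
theorem EmbedsInFunctionSpace.exists_nonempty {Z : Type u} [TopologicalSpace Z]
    (hZ : EmbedsInFunctionSpace Z) : ∃ (M : Type) (_ : TopologicalSpace M) (_ : MetrizableSpace M)
      (_ : SecondCountableTopology M) (_ : Nonempty M) (Y : Type u) (_ : TopologicalSpace Y)
      (_ : MetrizableSpace Y) (f : Z → C(M, Y)), IsEmbedding f := by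
  obtain ⟨M, _, _, _, Y, _, _, f, hf⟩ := hZ
  rcases isEmpty_or_nonempty M with hM | hM
  · have : Subsingleton Z := ⟨fun z w => hf.injective (ContinuousMap.ext fun x => hM.elim x)⟩
    exact ⟨Unit, inferInstance, inferInstance, inferInstance, inferInstance, PUnit, inferInstance,
      inferInstance, fun _ => .const _ PUnit.unit, .of_subsingleton _⟩
  · exact ⟨M, inferInstance, inferInstance, inferInstance, hM, Y, inferInstance, inferInstance, f,
      hf⟩

theorem EmbedsInFunctionSpace.pi {ι : Type} [Countable ι] {Z : ι → Type u}
    [∀ i, TopologicalSpace (Z i)] (h : ∀ i, EmbedsInFunctionSpace (Z i)) :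
    EmbedsInFunctionSpace (∀ i, Z i) := by
  choose M _ _ _ Y _ _ f hf using h
  refine ⟨Σ i, M i, inferInstance, inferInstance, inferInstance, Σ i, Y i, inferInstance,
    inferInstance, _, ContinuousMap.isEmbedding_sigma.comp
      (IsEmbedding.piMap fun i => ((ContinuousMap.sigmaMk (X := Y) i).isEmbedding_postcomp .sigmaMk).comp (hf i))⟩

theorem EmbedsInFunctionSpace.sigma {ι : Type} [Countable ι] {Z : ι → Type u}
    [∀ i, TopologicalSpace (Z i)] (h : ∀ i, EmbedsInFunctionSpace (Z i)) :
    EmbedsInFunctionSpace (Σ i, Z i) := by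
  classical
  rcases isEmpty_or_nonempty ι with hι | hι
  · have : DiscreteTopology (Σ i, Z i) := inferInstance
    exact of_metrizableSpace _
  choose M _ _ _ _ Y _ _ f hf using fun i => (h i).exists_nonempty
  let inl : ∀ i, C(Y i, Y i ⊕ Unit) := fun i => ⟨Sum.inl, continuous_inl⟩
  have hinl : ∀ i, IsEmbedding ((inl i).comp : C(M i, Y i) → C(M i, Y i ⊕ Unit)) :=
    fun i => (inl i).isEmbedding_postcomp .inl
  let c : ∀ i j, C(M j, Y i ⊕ Unit) := fun i j => .const _ (Sum.inr ())
  -- All summands need a common domain: extend each function off `M i` by the added isolated point.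
  let e : ∀ i, Z i → C(Σ j, M j, Y i ⊕ Unit) := fun i z =>
    ContinuousMap.sigma (Function.update (c i) i ((inl i).comp (f i z)))
  have hec : ∀ i, Continuous (e i) := fun i => ContinuousMap.continuous_sigma.comp
    (continuous_const.update i ((hinl i).continuous.comp (hf i).continuous))
  have he : ∀ i, IsEmbedding (e i) := by
    intro i
    refine IsEmbedding.of_comp (hec i)
      (ContinuousMap.continuous_precomp (ContinuousMap.sigmaMk (X := M) i)) ?_
    convert (hinl i).comp (hf i) using 1
    ext z x
    simp [e]
  have : Nonempty (Σ i, M i) := nonempty_sigma.2 ⟨hι.some, inferInstance⟩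
  exact ⟨Σ i, M i, inferInstance, inferInstance, inferInstance, Σ i, Y i ⊕ Unit, inferInstance,
    inferInstance, _, ContinuousMap.isEmbedding_sigmaMk_comp.comp
      ((isEmbedding_sigmaMap Function.injective_id).2 he)⟩

theorem EmbedsInFunctionSpace.continuousMap {Z W : Type u} [TopologicalSpace Z]
    [TopologicalSpace W] [LindelofSpace Z] (hZ : EmbedsInFunctionSpace Z)
    (hW : EmbedsInFunctionSpace W) : EmbedsInFunctionSpace C(Z, W) := by
  obtain ⟨M, _, _, _, Y, _, _, f, hf⟩ := hZ
  obtain ⟨M', _, _, _, Y', _, _, g, hg⟩ := hW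
  obtain ⟨N, p, hp⟩ := exists_compact_covering_of_lindelofSpace hf
  let _ := metrizableSpaceMetric Y'
  -- `N × M'` is first countable, hence sequential, so uncurrying needs no local compactness.
  exact ⟨N × M', inferInstance, inferInstance, inferInstance, Y', inferInstance, inferInstance, _,
    (ContinuousMap.isEmbedding_seqUncurry N M' Y').comp
      (((⟨g, hg.continuous⟩ : C(W, C(M', Y'))).isEmbedding_postcomp hg).comp
        (ContinuousMap.isEmbedding_precomp_of_compact_covering p hp))⟩

theorem isCkStableClass_embedsInFunctionSpace : IsCkStableClass.{u} EmbedsInFunctionSpace where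
  subspace _ _ h _ := h.of_isEmbedding .subtypeVal
  homeomorph _ _ _ _ h := fun ⟨e⟩ => h.of_isEmbedding e.symm.isEmbedding
  countable_sum _ _ _ _ h := .sigma h
  countable_prod _ _ _ _ h := .pi h
  function_space _ _ _ _ _ hX hY := hX.continuousMap hY

theorem EmbedsInFunctionSpace.isPOmegaOneOmegaSpace {Z : Type u} [TopologicalSpace Z]
    (hZ : EmbedsInFunctionSpace Z) : IsPOmegaOneOmegaSpace Z := by
  obtain ⟨M, _, _, _, Y, _, _, f, hf⟩ := hZ
  let _ := metrizableSpaceMetric Y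
  exact ContinuousMap.isPOmegaOneOmegaSpace M Y hf.isInducing

theorem mainTheorem9 (X : Type u) [TopologicalSpace X]
    (hX : CkStableClosure MetrizableClass X) : IsPOmegaOneOmegaSpace X :=
  (hX (fun Z _ => EmbedsInFunctionSpace Z) isCkStableClass_embedsInFunctionSpace
    fun Z _ (_ : MetrizableSpace Z) => .of_metrizableSpace Z).isPOmegaOneOmegaSpace
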